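/- An MV-algebra is an algebra $(A,\oplus,\lnot,0)$ such that $(A,\oplus,0)$ is a commutative monoid, $\lnot\lnot x=x$, $x\oplus\lnot 0=\lnot 0$ and $\lnot(\lnot x\oplus y)\oplus y=\lnot(\lnot y\oplus x)\oplus x$ for all $x,y$. Put $1:=\lnot 0$, $x\le y$ iff $\lnot x\oplus y=1$, $x\ominus y:=\lnot(\lnot x\oplus y)$ and $d(x,y):=(x\ominus y)\oplus(y\ominus x)$. An ideal is a non-empty, downward closed subset that is closed under $\oplus$; $A/I$ is the quotient by the congruence $d(x,y)\in I$. $\mathrm{Rad}(A)$ is the intersection of the maximal (proper) ideals of $A$; $A$ is semisimple if $\mathrm{Rad}(A)=\{0\}$, and perfect if $A=\mathrm{Rad}(A)\cup\lnot\mathrm{Rad}(A)$, where $\lnot S:=\{a\mid \lnot a\in S\}$. Let $P(A):=\mathrm{Rad}(A)\cup\lnot\mathrm{Rad}(A)$, a subalgebra of $A$, and $S(A):=A/\mathrm{Rad}(A)$. A class of zero objects in a category $\mathcal C$ is a full subcategory $\mathcal Z$ such that: every object $A$ has a monomorphism $Z\rightarrowtail A$ with $Z\in\mathcal Z$, unique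 up to isomorphism (its domain is the zero part $\mathrm Z(A)$); there is at most one arrow $Z\to A$ for $Z\in\mathcal Z$; and for $Z,Z'\in\mathcal Z$, every arrow $Z'\to A$ factors uniquely through every monomorphism $Z\rightarrowtail A$. Let $\mathcal N$ be the class of arrows that factor through an object of $\mathcal Z$. An arrow $k\colon K\to A$ is a $\mathcal Z$-kernel of $f\colon A\to B$ if $fk\in\mathcal N$ and every $e$ with $fe\in\mathcal N$ factors uniquely through $k$; $\mathcal Z$-cokernels are defined dually. A sequence $A\xrightarrow{f}B\xrightarrow{g}C$ is short exact if $f$ is a $\mathcal Z$-kernel of $g$ and $g$ is a $\mathcal Z$-cokernel of $f$. A torsion theory $(\mathcal T,\mathcal F)$ is a pair of full replete subcategories with $\mathcal Z=\mathcal T\cap\mathcal F$, $\mathrm{Hom}(T,F)\subseteq\mathcal N$ for all $T\in\mathcal T$, $F\in\mathcal F$, and such that every object $A$ is the middle term of a short exact sequence $T(A)\xrightarrow{t_A}A\xrightarrow{\eta_A}F(A)$ with $T(A)\in\mathcal T$, $F(A)\in\mathcal F$ (this sequence is then unique up to isomorphism). The torsion theory satisfies * (M) if $F(X)\cong \mathrm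 Z(Q)$ for every short exact sequence $X\to A\to Q$ with $X\in\mathcal T$; * (S) if, for every pullback $\chi\colon X'\to Z'$ of $\eta_X\colon X\to Z$ along an arrow $Z'\to Z$, with $X\in\mathcal T$ and $Z,Z'\in\mathcal Z$, one has $X'\in\mathcal T$ and $\chi=\eta_{X'}$ (up to isomorphism); * (N) if, for every $\mathcal Z$-kernel $k\colon K\to A$ of an arrow, $k\,t_K\colon T(K)\to A$ is the $\mathcal Z$-kernel of some arrow. **Theorem.** In the category $\mathbf{MV}$ of MV-algebras and their homomorphisms, the class $\mathcal Z$ of the algebras isomorphic to the $0$-algebra $\{0=1\}$ or to $\{0,1\}$ is a class of zero objects, and (perfect MV-algebras, semisimple MV-algebras) is a $\mathcal Z$-torsion theory. For every MV-algebra $A$ the sequence $P(A)\to A\to A/\mathrm{Rad}(A)$, given by inclusion and projection, is short exact with $P(A)$ perfect and $A/\mathrm{Rad}(A)$ semisimple, and every short exact sequence $T\to A\to F$ with $T$ perfect and $F$ semisimple is isomorphic to it by an isomorphism that is the identity on $A$. This torsion theory satisfies Conditions (M), (S) and (N). -/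

import Mathlib

open CategoryTheory

universe u v w

/-! ### Torsion theories relative to a class of zero objects -/

namespace ZeroTorsion

variable {C : Type u} [Category.{v} C]

/-- `Z` is a class of zero objects: a full subcategory such that every object has an essentially
unique subobject in `Z`, arrows out of an object of `Z` are unique when they exist, and every arrow
from an object of `Z` factors uniquely through each subobject in `Z` of its codomain. -/
structure IsZeroClass (Z : ObjectProperty C) : Prop where
  exists_mono : ∀ A : C, ∃ (Z₀ : C) (ε : Z₀ ⟶ A), Z Z₀ ∧ Mono ε
  mono_unique : ∀ {A Z₁ Z₂ : C} (ε₁ : Z₁ ⟶ A) (ε₂ : Z₂ ⟶ A), Z Z₁ → Z Z₂ → Mono ε₁ → Mono ε₂ →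
    ∃ e : Z₁ ≅ Z₂, e.hom ≫ ε₂ = ε₁
  hom_unique : ∀ {A Z₀ : C}, Z Z₀ → ∀ f g : Z₀ ⟶ A, f = g
  factors : ∀ {A Z₁ Z₂ : C} (z : Z₁ ⟶ A) (z' : Z₂ ⟶ A), Z Z₁ → Z Z₂ → Mono z →
    ∃! φ : Z₂ ⟶ Z₁, φ ≫ z = z'

/-- The ideal of the arrows that factor through an object of `Z`. -/
def FactorsThrough (Z : ObjectProperty C) {A B : C} (f : A ⟶ B) : Prop :=
  ∃ (Z₀ : C) (a : A ⟶ Z₀) (b : Z₀ ⟶ B), Z Z₀ ∧ a ≫ b = f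

/-- `k` is a `Z`-kernel of `f`. -/
structure IsZKernel (Z : ObjectProperty C) {K A B : C} (k : K ⟶ A) (f : A ⟶ B) : Prop where
  comp : FactorsThrough Z (k ≫ f)
  lift : ∀ {E : C} (e : E ⟶ A), FactorsThrough Z (e ≫ f) → ∃! φ : E ⟶ K, φ ≫ k = e

/-- `q` is a `Z`-cokernel of `f`. -/
structure IsZCokernel (Z : ObjectProperty C) {A B Q : C} (q : B ⟶ Q) (f : A ⟶ B) : Prop where
  comp : FactorsThrough Z (f ≫ q)
  desc : ∀ {E : C} (e : B ⟶ E), FactorsThrough Z (f ≫ e) → ∃! φ : Q ⟶ E, q ≫ φ = e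

/-- `A ⟶ B ⟶ D` is a short `Z`-exact sequence. -/
structure IsShortExact (Z : ObjectProperty C) {A B D : C} (f : A ⟶ B) (g : B ⟶ D) : Prop where
  kernel : IsZKernel Z f g
  cokernel : IsZCokernel Z g f

/-- `t : T₀ ⟶ A` and `η : A ⟶ F₀` form a short `Z`-exact sequence with torsion left end and
torsion-free right end. For a torsion theory this says that `T₀`, `F₀`, `t` and `η` are (a choice
of) the torsion part `T(A)`, the torsion-free part `F(A)`, the counit `t_A` and the unit `η_A`. -/
structure IsTorsionSequence (Z T F : ObjectProperty C) {T₀ A F₀ : C} (t : T₀ ⟶ A) (η : A ⟶ F₀) :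
    Prop where
  torsion : T T₀
  torsionFree : F F₀
  exact : IsShortExact Z t η

/-- `(T, F)` is a `Z`-torsion theory. -/
structure IsTorsionTheory (Z T F : ObjectProperty C) : Prop where
  replete_torsion : T.IsClosedUnderIsomorphisms
  replete_torsionFree : F.IsClosedUnderIsomorphisms
  inter : Z = T ⊓ F
  hom : ∀ {X Y : C}, T X → F Y → ∀ f : X ⟶ Y, FactorsThrough Z f
  exists_sequence : ∀ A : C, ∃ (T₀ F₀ : C) (t : T₀ ⟶ A) (η : A ⟶ F₀), IsTorsionSequence Z T F t η

/-- Condition (M): `F(X) ≅ Z(Q)` for every short exact sequence `X ⟶ A ⟶ Q` with `X` torsion.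
Here `Z(Q)`, the zero part of `Q`, is the domain of a monomorphism into `Q` from an object
of `Z`. -/
def ConditionM (Z T F : ObjectProperty C) : Prop :=
  ∀ {X A Q : C} (k : X ⟶ A) (q : A ⟶ Q), T X → IsShortExact Z k q →
    ∀ {T₀ F₀ : C} (t : T₀ ⟶ X) (η : X ⟶ F₀), IsTorsionSequence Z T F t η →
      ∀ {Z₀ : C} (ε : Z₀ ⟶ Q), Z Z₀ → Mono ε → Nonempty (F₀ ≅ Z₀)

/-- Condition (S): if the unit `η : X ⟶ Z₀` of a torsion object `X` is pulled back along an arrow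
`Z₁ ⟶ Z₀` between zero objects, then the resulting `χ : X' ⟶ Z₁` has torsion domain and is the
unit at `X'`. -/
def ConditionS (Z T F : ObjectProperty C) : Prop :=
  ∀ {X' Z₁ X Z₀ : C} (χ : X' ⟶ Z₁) (p : X' ⟶ X) (z : Z₁ ⟶ Z₀) (η : X ⟶ Z₀),
    T X → Z Z₀ → Z Z₁ → (∃ (T₀ : C) (t : T₀ ⟶ X), IsTorsionSequence Z T F t η) →
    IsPullback χ p z η →
      T X' ∧ ∃ (T₁ : C) (t' : T₁ ⟶ X'), IsTorsionSequence Z T F t' χ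

/-- Condition (N): for every `Z`-kernel `k : K ⟶ A`, the composite of the torsion part
`t : T(K) ⟶ K` with `k` is again a `Z`-kernel. -/
def ConditionN (Z T F : ObjectProperty C) : Prop :=
  ∀ {A B K : C} (f : A ⟶ B) (k : K ⟶ A), IsZKernel Z k f →
    ∀ {T₀ F₀ : C} (t : T₀ ⟶ K) (η : K ⟶ F₀), IsTorsionSequence Z T F t η →
      ∃ (D : C) (g : A ⟶ D), IsZKernel Z (t ≫ k) g

end ZeroTorsion

/-! ### MV-algebras -/

/-- An MV-algebra: `+` is the operation `⊕`, and `xᶜ` is the negation `¬ x`. -/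
class MVAlgebra (A : Type u) extends AddCommMonoid A, Compl A where
  compl_compl' : ∀ x : A, xᶜᶜ = x
  add_top' : ∀ x : A, x + 0ᶜ = 0ᶜ
  luk : ∀ x y : A, (xᶜ + y)ᶜ + y = (yᶜ + x)ᶜ + x

namespace MVAlgebra

variable {A : Type u} [MVAlgebra A]

/-- `x ≤ y` in the natural order of an MV-algebra. -/
def le (x y : A) : Prop := xᶜ + y = 0ᶜ

/-- The truncated difference `x ⊖ y`. -/
def sub (x y : A) : A := (xᶜ + y)ᶜ

/-- The distance `d(x, y)`. -/
def dist (x y : A) : A := sub x y + sub y x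

/-- Ideals of an MV-algebra. -/
structure IsIdeal (I : Set A) : Prop where
  nonempty : I.Nonempty
  down : ∀ {x y : A}, x ∈ I → le y x → y ∈ I
  add : ∀ {x y : A}, x ∈ I → y ∈ I → x + y ∈ I

/-- Maximal ideals: the maximal elements among the proper ideals. -/
def IsMaximalIdeal (I : Set A) : Prop :=
  Maximal (fun J : Set A => IsIdeal J ∧ J ≠ Set.univ) I

variable (A) in
/-- The radical: the intersection of the maximal ideals. -/
def rad : Set A := ⋂₀ {I : Set A | IsMaximalIdeal I}

variable (A) in
/-- An MV-algebra is semisimple if its radical is trivial. -/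
def IsSemisimple : Prop := rad A = {0}

variable (A) in
/-- An MV-algebra is perfect if each of its elements, or the negation of it, is in the radical. -/
def IsPerfect : Prop := rad A ∪ {a : A | aᶜ ∈ rad A} = Set.univ

theorem compl_add_self (x : A) : xᶜ + x = 0ᶜ := by
  have h := luk x 0ᶜ
  rw [add_top', compl_compl', zero_add] at h
  exact h.symm

theorem le_add (x c : A) : le x (x + c) := by
  unfold le
  rw [← add_assoc, compl_add_self, add_comm, add_top']

theorem add_sub_of_le {x y : A} (h : le x y) : x + sub y x = y := by
  unfold le at h
  rw [add_comm, sub, luk, h, compl_compl', zero_add]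

theorem le_trans' {x y z : A} (h₁ : le x y) (h₂ : le y z) : le x z := by
  rw [← add_sub_of_le h₂, ← add_sub_of_le h₁, add_assoc]
  exact le_add _ _

theorem add_le_add' {x y x' y' : A} (h₁ : le x y) (h₂ : le x' y') : le (x + x') (y + y') := by
  rw [← add_sub_of_le h₂, ← add_sub_of_le h₁, add_add_add_comm]
  exact le_add _ _

theorem le_add_sub (x y : A) : le x (y + sub x y) := by
  unfold le sub
  rw [← add_assoc, add_comm, compl_add_self]

theorem sub_le {x y z : A} (h : le x (y + z)) : le (sub x y) z := by
  unfold le sub at *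
  rw [compl_compl', add_assoc, h]

theorem sub_self' (x : A) : sub x x = 0 := by
  rw [sub, compl_add_self, compl_compl']

theorem sub_triangle (x y z : A) : le (sub x z) (sub x y + sub y z) := by
  apply sub_le
  refine le_trans' (le_add_sub x y) ?_
  rw [add_left_comm, add_comm y]
  exact add_le_add' (by simpa using le_add (sub x y) 0) (le_add_sub y z)

theorem sub_add_add (x y x' y' : A) : le (sub (x + x') (y + y')) (sub x y + sub x' y') := by
  apply sub_le
  rw [add_add_add_comm]
  exact add_le_add' (le_add_sub x y) (le_add_sub x' y')

theorem compl_sub_compl (x y : A) : sub xᶜ yᶜ = sub y x := by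
  rw [sub, sub, compl_compl', add_comm]

theorem zero_le' (x : A) : le 0 x := by
  unfold le
  rw [add_comm, add_top']

namespace IsIdeal

variable {I : Set A}

theorem zero_mem (hI : IsIdeal I) : (0 : A) ∈ I :=
  let ⟨_, hx⟩ := hI.nonempty
  hI.down hx (zero_le' _)

theorem dist_mem_iff (hI : IsIdeal I) {x y : A} :
    dist x y ∈ I ↔ sub x y ∈ I ∧ sub y x ∈ I := by
  refine ⟨fun h => ⟨hI.down h (le_add _ _), hI.down h ?_⟩, fun h => hI.add h.1 h.2⟩
  rw [dist, add_comm]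
  exact le_add _ _

/-- The congruence induced by an ideal: `x ~ y` if and only if `d(x, y) ∈ I`. -/
def setoid (hI : IsIdeal I) : Setoid A where
  r x y := dist x y ∈ I
  iseqv :=
    { refl := fun x => by
        rw [hI.dist_mem_iff, sub_self']
        exact ⟨hI.zero_mem, hI.zero_mem⟩
      symm := fun {x y} h => by
        rw [hI.dist_mem_iff] at *
        exact h.symm
      trans := fun {x y z} h₁ h₂ => by
        rw [hI.dist_mem_iff] at *
        exact ⟨hI.down (hI.add h₁.1 h₂.1) (sub_triangle _ _ _),
          hI.down (hI.add h₂.2 h₁.2) (sub_triangle _ _ _)⟩ }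

theorem setoid_add (hI : IsIdeal I) {x y x' y' : A} (h : hI.setoid.r x y)
    (h' : hI.setoid.r x' y') : hI.setoid.r (x + x') (y + y') := by
  change dist _ _ ∈ I at h h' ⊢
  rw [hI.dist_mem_iff] at *
  exact ⟨hI.down (hI.add h.1 h'.1) (sub_add_add _ _ _ _),
    hI.down (hI.add h.2 h'.2) (sub_add_add _ _ _ _)⟩

theorem setoid_compl (hI : IsIdeal I) {x y : A} (h : hI.setoid.r x y) :
    hI.setoid.r xᶜ yᶜ := by
  change dist _ _ ∈ I at h ⊢
  rw [hI.dist_mem_iff] at *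
  rw [compl_sub_compl, compl_sub_compl]
  exact h.symm

/-- The quotient `A / I`. -/
def Quot (hI : IsIdeal I) : Type u := Quotient hI.setoid

/-- The class of an element in `A / I`. -/
def toQuot (hI : IsIdeal I) (a : A) : hI.Quot := Quotient.mk hI.setoid a

instance (hI : IsIdeal I) : Add hI.Quot where
  add := Quotient.map₂ (· + ·) fun _ _ h _ _ h' => hI.setoid_add h h'

instance (hI : IsIdeal I) : Zero hI.Quot where
  zero := hI.toQuot 0

/-- `A / I` is an MV-algebra under the induced operations. -/
instance (hI : IsIdeal I) : MVAlgebra hI.Quot where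
  compl := Quotient.map (·ᶜ) fun _ _ h => hI.setoid_compl h
  nsmul := nsmulRec
  add_assoc := by
    rintro ⟨a⟩ ⟨b⟩ ⟨c⟩
    exact congrArg hI.toQuot (add_assoc a b c)
  zero_add := by
    rintro ⟨a⟩
    exact congrArg hI.toQuot (zero_add a)
  add_zero := by
    rintro ⟨a⟩
    exact congrArg hI.toQuot (add_zero a)
  add_comm := by
    rintro ⟨a⟩ ⟨b⟩
    exact congrArg hI.toQuot (add_comm a b)
  compl_compl' := by
    rintro ⟨a⟩
    exact congrArg hI.toQuot (compl_compl' a)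
  add_top' := by
    rintro ⟨a⟩
    exact congrArg hI.toQuot (add_top' a)
  luk := by
    rintro ⟨a⟩ ⟨b⟩
    exact congrArg hI.toQuot (luk a b)

/-- The subset `I ∪ ¬ I` of `A`, as a type. -/
def Sub (_ : IsIdeal I) : Type u := {a : A // a ∈ I ∪ {a : A | aᶜ ∈ I}}

theorem sub_add_mem (hI : IsIdeal I) {x y : A} (hx : x ∈ I ∪ {a : A | aᶜ ∈ I})
    (hy : y ∈ I ∪ {a : A | aᶜ ∈ I}) : x + y ∈ I ∪ {a : A | aᶜ ∈ I} := by
  have key : ∀ a b : A, aᶜ ∈ I → (a + b)ᶜ ∈ I := fun a b ha => by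
    refine hI.down ha ?_
    have h := le_add a b
    unfold le at *
    rw [compl_compl', add_comm, h]
  rcases hx with hx | hx
  · rcases hy with hy | hy
    · exact Or.inl (hI.add hx hy)
    · right
      rw [add_comm]
      exact key _ _ hy
  · exact Or.inr (key _ _ hx)

theorem sub_compl_mem (_ : IsIdeal I) {x : A} (hx : x ∈ I ∪ {a : A | aᶜ ∈ I}) :
    xᶜ ∈ I ∪ {a : A | aᶜ ∈ I} := by
  rcases hx with hx | hx
  · right
    simpa [compl_compl'] using hx
  · exact Or.inl hx

instance (hI : IsIdeal I) : Add hI.Sub where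
  add x y := ⟨x.1 + y.1, hI.sub_add_mem x.2 y.2⟩

instance (hI : IsIdeal I) : Zero hI.Sub where
  zero := ⟨0, Or.inl hI.zero_mem⟩

/-- `I ∪ ¬ I` is an MV-algebra under the operations of `A`. -/
instance (hI : IsIdeal I) : MVAlgebra hI.Sub where
  compl x := ⟨x.1ᶜ, hI.sub_compl_mem x.2⟩
  nsmul := nsmulRec
  add_assoc x y z := Subtype.ext (add_assoc x.1 y.1 z.1)
  zero_add x := Subtype.ext (zero_add x.1)
  add_zero x := Subtype.ext (add_zero x.1)
  add_comm x y := Subtype.ext (add_comm x.1 y.1)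
  compl_compl' x := Subtype.ext (compl_compl' x.1)
  add_top' x := Subtype.ext (add_top' x.1)
  luk x y := Subtype.ext (luk x.1 y.1)

end IsIdeal

theorem IsMaximalIdeal.isIdeal {I : Set A} (h : IsMaximalIdeal I) : IsIdeal I :=
  h.1.1

variable (A) in
theorem isIdeal_rad : IsIdeal (rad A) where
  nonempty := ⟨0, fun _ hI => (IsMaximalIdeal.isIdeal hI).zero_mem⟩
  down hx h := fun I hI => (IsMaximalIdeal.isIdeal hI).down (hx I hI) h
  add hx hy := fun I hI => (IsMaximalIdeal.isIdeal hI).add (hx I hI) (hy I hI)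

end MVAlgebra

/-! ### The category of MV-algebras -/

/-- Homomorphisms of MV-algebras: maps that preserve `⊕`, `0` and `¬`. -/
structure MVHom (A : Type u) (B : Type v) [MVAlgebra A] [MVAlgebra B] extends A →+ B where
  map_compl' : ∀ a : A, toFun aᶜ = (toFun a)ᶜ

instance (A : Type u) (B : Type v) [MVAlgebra A] [MVAlgebra B] : FunLike (MVHom A B) A B where
  coe f := f.toFun
  coe_injective f g h := by
    rcases f with ⟨f, _⟩
    rcases g with ⟨g, _⟩
    congr 1
    exact DFunLike.coe_injective h

/-- The category of MV-algebras. -/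
structure MVCat where
  /-- The underlying type. -/
  carrier : Type u
  [str : MVAlgebra carrier]

namespace MVCat

instance : CoeSort MVCat.{u} (Type u) := ⟨carrier⟩

instance (A : MVCat.{u}) : MVAlgebra A := A.str

instance : Category MVCat.{u} where
  Hom A B := MVHom A B
  id A := { AddMonoidHom.id A with map_compl' := fun _ => rfl }
  comp f g :=
    { g.toAddMonoidHom.comp f.toAddMonoidHom with
      map_compl' := fun a =>
        (congrArg g.toFun (f.map_compl' a)).trans (g.map_compl' (f.toFun a)) }

instance : ConcreteCategory MVCat.{u} (fun A B => MVHom A B) where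
  hom f := f
  ofHom f := f

/-- The `0`-algebra, in which `0 = 1`. -/
def trivialAlg : MVCat.{u} :=
  letI : MVAlgebra PUnit.{u + 1} :=
    { compl := fun _ => PUnit.unit
      compl_compl' := fun _ => rfl
      add_top' := fun _ => rfl
      luk := fun _ _ => rfl }
  ⟨PUnit.{u + 1}⟩

/-- A type with two elements. -/
inductive Two : Type u
  | zero : Two
  | one : Two

instance : Add Two.{u} where
  add
    | .zero, y => y
    | .one, _ => .one

instance : Zero Two.{u} where
  zero := .zero

/-- The MV-algebra structure of `{0, 1}`: `⊕` is disjunction, and `¬` exchanges `0` and `1`. -/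
instance : MVAlgebra Two.{u} where
  compl
    | .zero => .one
    | .one => .zero
  nsmul := nsmulRec
  add_assoc := by rintro ⟨⟩ ⟨⟩ ⟨⟩ <;> rfl
  zero_add := by rintro ⟨⟩ <;> rfl
  add_zero := by rintro ⟨⟩ <;> rfl
  add_comm := by rintro ⟨⟩ ⟨⟩ <;> rfl
  compl_compl' := by rintro ⟨⟩ <;> rfl
  add_top' := by rintro ⟨⟩ <;> rfl
  luk := by rintro ⟨⟩ ⟨⟩ <;> rfl

/-- The MV-algebra `{0, 1}`. -/
def twoAlg : MVCat.{u} := ⟨Two.{u}⟩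

/-- The class consisting of the `0`-algebra and of `{0, 1}` (closed under isomorphism). -/
def zeros : ObjectProperty MVCat.{u} :=
  fun A => Nonempty (A ≅ trivialAlg) ∨ Nonempty (A ≅ twoAlg)

/-- The perfect MV-algebras. -/
def perfect : ObjectProperty MVCat.{u} := fun A => MVAlgebra.IsPerfect A

/-- The semisimple MV-algebras. -/
def semisimple : ObjectProperty MVCat.{u} := fun A => MVAlgebra.IsSemisimple A

/-- The subalgebra `P(A) = Rad(A) ∪ ¬ Rad(A)`. -/
def P (A : MVCat.{u}) : MVCat.{u} := ⟨(MVAlgebra.isIdeal_rad A).Sub⟩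

/-- The quotient `S(A) = A / Rad(A)`. -/
def S (A : MVCat.{u}) : MVCat.{u} := ⟨(MVAlgebra.isIdeal_rad A).Quot⟩

/-- The inclusion `P(A) ⟶ A`. -/
def incl (A : MVCat.{u}) : P A ⟶ A :=
  ConcreteCategory.ofHom (C := MVCat.{u}) (X := P A) (Y := A)
    { toFun := fun x => x.1
      map_zero' := rfl
      map_add' := fun _ _ => rfl
      map_compl' := fun _ => rfl }

/-- The projection `A ⟶ A / Rad(A)`. -/
def proj (A : MVCat.{u}) : A ⟶ S A :=
  ConcreteCategory.ofHom (C := MVCat.{u}) (X := A) (Y := S A)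
    { toFun := fun a => (MVAlgebra.isIdeal_rad A).toQuot a
      map_zero' := rfl
      map_add' := fun _ _ => rfl
      map_compl' := fun _ => rfl }

end MVCat

/-!
A homomorphism of MV-algebras factors through a zero object exactly when it only takes the values
`0` and `1`, so the `Z`-kernels of `f : A ⟶ B` are the injective homomorphisms with range
`{a | f a = 0 ∨ f a = 1}`, that is `I ∪ ¬ I` for the ideal `I = f⁻¹(0)`
(`MVCat.isZKernel_iff`). Two facts about the radical carry the proof.

* Preimages of maximal ideals are maximal, because a proper ideal `M` is maximal if and only if
  every `a ∉ M` has a multiple `n a` with `¬ (n a) ∈ M`. Hence homomorphisms preserve the radical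
  (`MVHom.map_mem_rad`), and so every homomorphism from a perfect to a semisimple algebra is
  two-valued.
* Every `y ∈ Rad(A)` satisfies `y ≤ ¬ y` (`MVAlgebra.le_compl_of_mem_rad`). Indeed
  `y ⊖ ¬ y` and `¬ y ⊖ y = ¬ (y ⊕ y)` are orthogonal; if the former is nonzero, then the elements
  orthogonal to it form a proper ideal, and a maximal ideal above that one contains `¬ (y ⊕ y)`
  and `y`, which is absurd. Consequently a maximal ideal of `P(A)` contains `Rad(A)`, so that
  `P(A)` is perfect, and a two-valued homomorphism vanishes on the radical, so that `A / Rad(A)` is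
  the `Z`-cokernel of `P(A) ⟶ A`.

The uniqueness of the torsion sequence is formal. It reduces Conditions (M), (S) and (N) to
statements about elements: (M) and (S) amount to comparing which algebras are trivial, and for (N)
the radical of a `Z`-kernel `K` of `f : A ⟶ B` lies in `f⁻¹(0) ⊆ K`, so it is an ideal `J` of `A`,
and `P(K)` is the `Z`-kernel of `A ⟶ A / J`.
-/

/-! ### Formal properties of `Z`-kernels and `Z`-cokernels -/

namespace ZeroTorsion

variable {C : Type u} [Category.{v} C] {Z T F : ObjectProperty C}

theorem FactorsThrough.comp_left {A B D : C} {f : A ⟶ B} (hf : FactorsThrough Z f) (g : D ⟶ A) :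
    FactorsThrough Z (g ≫ f) := by
  obtain ⟨Z₀, a, b, hZ, rfl⟩ := hf
  exact ⟨Z₀, g ≫ a, b, hZ, by simp⟩

theorem FactorsThrough.comp_right {A B D : C} {f : A ⟶ B} (hf : FactorsThrough Z f) (g : B ⟶ D) :
    FactorsThrough Z (f ≫ g) := by
  obtain ⟨Z₀, a, b, hZ, rfl⟩ := hf
  exact ⟨Z₀, a, b ≫ g, hZ, by simp⟩

theorem IsZKernel.mono {K A B : C} {k : K ⟶ A} {f : A ⟶ B} (h : IsZKernel Z k f) : Mono k where
  right_cancellation φ ψ e := by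
    have hφ : FactorsThrough Z ((φ ≫ k) ≫ f) := by simpa using h.comp.comp_left φ
    exact (h.lift _ hφ).unique rfl e.symm

theorem IsZCokernel.epi {A B Q : C} {q : B ⟶ Q} {f : A ⟶ B} (h : IsZCokernel Z q f) : Epi q where
  left_cancellation φ ψ e := by
    have hφ : FactorsThrough Z (f ≫ q ≫ φ) := by simpa using h.comp.comp_right φ
    exact (h.desc _ hφ).unique rfl e.symm

theorem IsZKernel.exists_iso {K A B K' B' : C} {k : K ⟶ A} {f : A ⟶ B} {k' : K' ⟶ A} {f' : A ⟶ B'}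
    (h : IsZKernel Z k f) (h' : IsZKernel Z k' f') (hk : FactorsThrough Z (k ≫ f'))
    (hk' : FactorsThrough Z (k' ≫ f)) : ∃ e : K ≅ K', e.hom ≫ k' = k := by
  obtain ⟨φ, hφ, -⟩ := h'.lift k hk
  obtain ⟨ψ, hψ, -⟩ := h.lift k' hk'
  have := h.mono
  have := h'.mono
  exact ⟨⟨φ, ψ, by simp [← cancel_mono k, hφ, hψ], by simp [← cancel_mono k', hφ, hψ]⟩, hφ⟩

theorem IsZCokernel.exists_iso {A B Q A' Q' : C} {q : B ⟶ Q} {f : A ⟶ B} {q' : B ⟶ Q'} {f' : A' ⟶ B}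
    (h : IsZCokernel Z q f) (h' : IsZCokernel Z q' f') (hq : FactorsThrough Z (f' ≫ q))
    (hq' : FactorsThrough Z (f ≫ q')) : ∃ e : Q ≅ Q', q ≫ e.hom = q' := by
  obtain ⟨φ, hφ, -⟩ := h.desc q' hq'
  obtain ⟨ψ, hψ, -⟩ := h'.desc q hq
  have := h.epi
  have := h'.epi
  exact ⟨⟨φ, ψ, by simp [← cancel_epi q, reassoc_of% hφ, hψ],
    by simp [← cancel_epi q', reassoc_of% hψ, hφ]⟩, hφ⟩

/-- Torsion sequences with the same middle term are isomorphic, as soon as all arrows from torsion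
to torsion-free objects factor through `Z`. -/
theorem IsTorsionSequence.exists_iso
    (hom : ∀ {X Y : C}, T X → F Y → ∀ f : X ⟶ Y, FactorsThrough Z f)
    {T₀ A F₀ T₁ F₁ : C} {t : T₀ ⟶ A} {η : A ⟶ F₀} {t' : T₁ ⟶ A} {η' : A ⟶ F₁}
    (h : IsTorsionSequence Z T F t η) (h' : IsTorsionSequence Z T F t' η') :
    ∃ (e : T₀ ≅ T₁) (e' : F₀ ≅ F₁), e.hom ≫ t' = t ∧ η ≫ e'.hom = η' := by
  have h₁ := hom h.torsion h'.torsionFree (t ≫ η')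
  have h₂ := hom h'.torsion h.torsionFree (t' ≫ η)
  obtain ⟨e, he⟩ := h.exact.kernel.exists_iso h'.exact.kernel h₁ h₂
  obtain ⟨e', he'⟩ := h.exact.cokernel.exists_iso h'.exact.cokernel h₂ h₁
  exact ⟨e, e', he, he'⟩

end ZeroTorsion

/-! ### Order and subtraction in MV-algebras -/

namespace MVAlgebra

variable {A : Type u} [MVAlgebra A]

theorem compl_injective : Function.Injective (fun x : A => xᶜ) := fun x y h => by
  rw [← compl_compl' x, ← compl_compl' y]
  exact congrArg _ h

theorem compl_eq_zero_iff {x : A} : xᶜ = 0 ↔ x = 0ᶜ :=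
  ⟨fun h => by rw [← h, compl_compl'], fun h => by rw [h, compl_compl']⟩

theorem le_refl' (x : A) : le x x := compl_add_self x

theorem le_top' (x : A) : le x 0ᶜ := add_top' _

theorem eq_zero_of_le_zero {x : A} (h : le x 0) : x = 0 := by
  unfold le at h
  rw [add_zero] at h
  exact compl_injective h

theorem sub_zero' (x : A) : sub x 0 = x := by
  rw [sub, add_zero, compl_compl']

theorem zero_sub' (x : A) : sub 0 x = 0 := by
  rw [sub, add_comm, add_top', compl_compl']

theorem sub_top (x : A) : sub x 0ᶜ = 0 := by
  rw [sub, add_top', compl_compl']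

theorem sub_sub' (x y z : A) : sub (sub x y) z = sub x (y + z) := by
  rw [sub, sub, sub, compl_compl', add_assoc]

theorem sup_comm' (x y : A) : x + sub y x = y + sub x y := by
  rw [sub, sub, add_comm, luk, add_comm]

theorem sub_le_sub_left' {x y : A} (z : A) (h : le x y) : le (sub z y) (sub z x) :=
  sub_le (le_trans' (le_add_sub z x) (add_le_add' h (le_refl' _)))

theorem sub_le_sub_right' {x y : A} (z : A) (h : le x y) : le (sub x z) (sub y z) :=
  sub_le (le_trans' h (le_add_sub y z))

theorem sub_le_self' (x y : A) : le (sub x y) x :=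
  sub_le (by rw [add_comm]; exact le_add x y)

/-- The differences `x ⊖ y` and `y ⊖ x` are orthogonal: subtracting one from the other has no
effect. -/
theorem sub_le_sub_sub (x y : A) : le (sub x y) (sub (sub x y) (sub y x)) := by
  rw [sub_sub']
  apply sub_le
  have h : le x (sub x (sub y x) + sub y (sub x (sub y x))) := by
    refine le_trans' (le_add_sub x (sub y x)) ?_
    rw [add_comm]
    exact add_le_add' (le_refl' _) (sub_le_sub_left' y (sub_le_self' _ _))
  rwa [sup_comm', sub_sub', add_comm (sub y x)] at h

theorem subsingleton_of_top_eq_zero (h : (0 : A)ᶜ = 0) : Subsingleton A :=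
  subsingleton_of_forall_eq 0 fun x => eq_zero_of_le_zero (h ▸ le_top' x)

/-! ### Maximal ideals and the radical -/

theorem IsIdeal.eq_univ {I : Set A} (hI : IsIdeal I) (h : (0 : A)ᶜ ∈ I) : I = Set.univ :=
  Set.eq_univ_of_forall fun x => hI.down h (le_top' x)

theorem IsIdeal.ne_univ_iff {I : Set A} (hI : IsIdeal I) : I ≠ Set.univ ↔ (0 : A)ᶜ ∉ I :=
  not_congr ⟨fun h => h ▸ Set.mem_univ _, hI.eq_univ⟩

theorem IsIdeal.mem_of_sub_mem {I : Set A} (hI : IsIdeal I) {x y : A} (hy : y ∈ I)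
    (h : sub x y ∈ I) : x ∈ I :=
  hI.down (hI.add hy h) (le_add_sub x y)

theorem IsIdeal.not_compl_mem {I : Set A} (hI : IsIdeal I) (h : I ≠ Set.univ) {x : A}
    (hx : x ∈ I) : xᶜ ∉ I := fun hx' =>
  hI.ne_univ_iff.1 h (compl_add_self x ▸ hI.add hx' hx)

theorem IsIdeal.nsmul_mem {I : Set A} (hI : IsIdeal I) {x : A} (hx : x ∈ I) (n : ℕ) :
    n • x ∈ I := by
  induction n with
  | zero => rw [zero_nsmul]; exact hI.zero_mem
  | succ n ih => rw [succ_nsmul]; exact hI.add ih hx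

theorem isIdeal_zero : IsIdeal ({0} : Set A) where
  nonempty := ⟨0, rfl⟩
  down hx h := eq_zero_of_le_zero (by rwa [Set.mem_singleton_iff.1 hx] at h)
  add hx hy := by
    rw [Set.mem_singleton_iff] at *
    rw [hx, hy, add_zero]

theorem IsIdeal.exists_isMaximalIdeal {I : Set A} (hI : IsIdeal I) (h : I ≠ Set.univ) :
    ∃ M, IsMaximalIdeal M ∧ I ⊆ M := by
  obtain ⟨M, hIM, hM⟩ := zorn_subset_nonempty {J : Set A | IsIdeal J ∧ J ≠ Set.univ}
    (fun c hc hch ⟨J₀, hJ₀⟩ => by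
      have hU : IsIdeal (⋃₀ c) :=
        { nonempty := ⟨0, J₀, hJ₀, (hc hJ₀).1.zero_mem⟩
          down := fun ⟨J, hJ, hx⟩ hle => ⟨J, hJ, (hc hJ).1.down hx hle⟩
          add := fun ⟨J, hJ, hx⟩ ⟨J', hJ', hy⟩ => by
            rcases hch.total hJ hJ' with hle | hle
            · exact ⟨J', hJ', (hc hJ').1.add (hle hx) hy⟩
            · exact ⟨J, hJ, (hc hJ).1.add hx (hle hy)⟩ }
      refine ⟨⋃₀ c, ⟨hU, hU.ne_univ_iff.2 ?_⟩, fun J hJ => Set.subset_sUnion_of_mem hJ⟩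
      rintro ⟨J, hJ, hx⟩
      exact (hc hJ).1.ne_univ_iff.1 (hc hJ).2 hx) I ⟨hI, h⟩
  exact ⟨M, hM, hIM⟩

/-- An element outside a maximal ideal generates with it the whole algebra, hence has a multiple
whose negation lies in the ideal. -/
theorem IsMaximalIdeal.exists_compl_nsmul_mem {M : Set A} (hM : IsMaximalIdeal M) {a : A}
    (ha : a ∉ M) : ∃ n : ℕ, (n • a)ᶜ ∈ M := by
  have hJ : IsIdeal {x : A | ∃ m ∈ M, ∃ n : ℕ, le x (m + n • a)} :=
    { nonempty := ⟨0, 0, hM.isIdeal.zero_mem, 0, zero_le' _⟩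
      down := fun ⟨m, hm, n, h⟩ hle => ⟨m, hm, n, le_trans' hle h⟩
      add := fun ⟨m, hm, n, h⟩ ⟨m', hm', n', h'⟩ => ⟨m + m', hM.isIdeal.add hm hm', n + n', by
        rw [add_nsmul, add_add_add_comm]
        exact add_le_add' h h'⟩ }
  by_contra hn
  have hle := hM.2 (y := {x : A | ∃ m ∈ M, ∃ n : ℕ, le x (m + n • a)}) ⟨hJ, hJ.ne_univ_iff.2 ?_⟩
    fun m hm => ⟨m, hm, 0, le_add _ _⟩
  · exact ha (hle ⟨0, hM.isIdeal.zero_mem, 1, by simpa using le_refl' a⟩)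
  · rintro ⟨m, hm, n, h⟩
    refine hn ⟨n, hM.isIdeal.down hm ?_⟩
    unfold le at h ⊢
    rw [compl_compl', zero_add] at h
    rwa [compl_compl', add_comm]

theorem IsIdeal.isMaximalIdeal {I : Set A} (hI : IsIdeal I) (h : I ≠ Set.univ)
    (hn : ∀ a, a ∉ I → ∃ n : ℕ, (n • a)ᶜ ∈ I) : IsMaximalIdeal I := by
  refine ⟨⟨hI, h⟩, fun J hJ hle a ha => ?_⟩
  by_contra haI
  obtain ⟨n, hn⟩ := hn a haI
  exact hJ.1.not_compl_mem hJ.2 (hJ.1.nsmul_mem ha n) (hle hn)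

/-- The elements orthogonal to `z`, that is, those whose subtraction from `z` has no effect, form
an ideal. -/
theorem isIdeal_polar (z : A) : IsIdeal {x : A | le z (sub z x)} where
  nonempty := ⟨0, by simpa [sub_zero'] using le_refl' z⟩
  down hx h := le_trans' hx (sub_le_sub_left' z h)
  add {x y} hx hy := by
    change le z (sub z (x + y))
    rw [← sub_sub']
    exact le_trans' hy (sub_le_sub_right' y hx)

/-- The elements of the radical are at most equal to their negations. -/
theorem le_compl_of_mem_rad {y : A} (hy : y ∈ rad A) : le y yᶜ := by
  by_contra hle
  have hI := isIdeal_polar (sub y yᶜ)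
  obtain ⟨M, hM, hIM⟩ := hI.exists_isMaximalIdeal <| hI.ne_univ_iff.2 fun h => hle <| by
    have h0 : sub y yᶜ = 0 := eq_zero_of_le_zero (by simpa [sub_top] using h)
    exact compl_injective (by simpa [sub, compl_compl'] using h0)
  have hw : (y + y)ᶜ ∈ M := by
    have := hIM (sub_le_sub_sub y yᶜ)
    rwa [sub, compl_compl'] at this
  have hyM : y ∈ M := hy M hM
  exact hM.isIdeal.not_compl_mem hM.1.2 (hM.isIdeal.add hyM hyM) hw

theorem subsingleton_of_top_mem_rad (h : (0 : A)ᶜ ∈ rad A) : Subsingleton A :=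
  subsingleton_of_top_eq_zero <| eq_zero_of_le_zero <| by
    simpa [compl_compl'] using le_compl_of_mem_rad h

theorem IsIdeal.dist_zero_mem_iff {I : Set A} (hI : IsIdeal I) {x : A} : dist x 0 ∈ I ↔ x ∈ I := by
  rw [hI.dist_mem_iff, sub_zero', zero_sub']
  exact ⟨fun h => h.1, fun h => ⟨h, hI.zero_mem⟩⟩

theorem IsIdeal.toQuot_eq_iff {I : Set A} (hI : IsIdeal I) {x y : A} :
    hI.toQuot x = hI.toQuot y ↔ dist x y ∈ I :=
  ⟨fun h => Quotient.exact h, fun h => Quotient.sound h⟩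

theorem IsIdeal.toQuot_eq_zero_iff {I : Set A} (hI : IsIdeal I) {x : A} :
    hI.toQuot x = 0 ↔ x ∈ I :=
  hI.toQuot_eq_iff.trans hI.dist_zero_mem_iff

end MVAlgebra

/-! ### Homomorphisms of MV-algebras -/

open MVAlgebra

instance (A : Type u) (B : Type v) [MVAlgebra A] [MVAlgebra B] :
    AddMonoidHomClass (MVHom A B) A B where
  map_add f := f.map_add'
  map_zero f := f.map_zero'

namespace MVHom

variable {A : Type u} {B : Type v} [MVAlgebra A] [MVAlgebra B] (f : MVHom A B)

theorem map_compl (a : A) : f aᶜ = (f a)ᶜ := f.map_compl' a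

theorem map_top : f 0ᶜ = 0ᶜ := by rw [map_compl, map_zero]

theorem map_sub' (x y : A) : f (sub x y) = sub (f x) (f y) := by
  simp only [sub, map_compl, map_add]

theorem map_le {x y : A} (h : le x y) : le (f x) (f y) := by
  unfold le at *
  rw [← map_compl, ← map_add, h, map_top]

theorem subsingleton (f : MVHom A B) [Subsingleton A] : Subsingleton B :=
  subsingleton_of_top_eq_zero <| by
    rw [← map_top f, ← map_zero f, Subsingleton.elim (0 : A)ᶜ 0]

theorem isIdeal_comap {I : Set B} (hI : IsIdeal I) : IsIdeal (f ⁻¹' I) where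
  nonempty := ⟨0, by rw [Set.mem_preimage, map_zero]; exact hI.zero_mem⟩
  down hx h := hI.down hx (f.map_le h)
  add {x y} hx hy := by
    rw [Set.mem_preimage, map_add]
    exact hI.add hx hy

theorem comap_ne_univ {I : Set B} (hI : IsIdeal I) (h : I ≠ Set.univ) : f ⁻¹' I ≠ Set.univ := by
  rw [(f.isIdeal_comap hI).ne_univ_iff, Set.mem_preimage, map_top]
  exact hI.ne_univ_iff.1 h

theorem isMaximalIdeal_comap {M : Set B} (hM : IsMaximalIdeal M) : IsMaximalIdeal (f ⁻¹' M) := by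
  refine (f.isIdeal_comap hM.isIdeal).isMaximalIdeal (f.comap_ne_univ hM.isIdeal hM.1.2)
    fun a ha => ?_
  obtain ⟨n, hn⟩ := hM.exists_compl_nsmul_mem ha
  exact ⟨n, by rwa [Set.mem_preimage, map_compl, map_nsmul]⟩

theorem map_mem_rad {a : A} (ha : a ∈ rad A) : f a ∈ rad B := fun _ hM =>
  ha _ (f.isMaximalIdeal_comap hM)

/-- A surjective homomorphism whose kernel lies in the radical reflects the radical. -/
theorem mem_rad_of_map_mem_rad (hf : Function.Surjective f) (hker : ∀ a, f a = 0 → a ∈ rad A)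
    {a : A} (ha : f a ∈ rad B) : a ∈ rad A := by
  intro M hM
  have hM' : ∀ x, f x ∈ f '' M → x ∈ M := by
    rintro x ⟨y, hy, hxy⟩
    refine hM.isIdeal.mem_of_sub_mem hy (hker _ ?_ M hM)
    rw [map_sub', hxy, sub_self']
  have hI : IsIdeal (f '' M) :=
    { nonempty := hM.isIdeal.nonempty.image f
      down := by
        rintro _ z ⟨x, hx, rfl⟩ hle
        obtain ⟨w, rfl⟩ := hf z
        -- `w` itself need not lie below `x`, but `w ⊖ x` is in the kernel.
        refine ⟨w, hM.isIdeal.mem_of_sub_mem hx (hker _ ?_ M hM), rfl⟩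
        rw [map_sub', sub, hle, compl_compl']
      add := by
        rintro _ _ ⟨x, hx, rfl⟩ ⟨y, hy, rfl⟩
        exact ⟨x + y, hM.isIdeal.add hx hy, map_add f x y⟩ }
  refine hM' a (ha _ (hI.isMaximalIdeal ?_ fun b hb => ?_))
  · rw [hI.ne_univ_iff, ← map_top f]
    exact fun h => hM.isIdeal.ne_univ_iff.1 hM.1.2 (hM' _ h)
  · obtain ⟨x, rfl⟩ := hf b
    obtain ⟨n, hn⟩ := hM.exists_compl_nsmul_mem fun hx => hb ⟨x, hx, rfl⟩
    exact ⟨n, _, hn, by rw [map_compl, map_nsmul]⟩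

/-- A homomorphism that is two-valued on the radical vanishes on it. -/
theorem map_eq_zero_of_mem_rad {a : A} (ha : a ∈ rad A) (h : f a = 0 ∨ f a = 0ᶜ) : f a = 0 := by
  rcases h with h | h
  · exact h
  · have := f.map_le (le_compl_of_mem_rad ha)
    rw [map_compl, h, compl_compl'] at this
    rw [h, eq_zero_of_le_zero this]

end MVHom

namespace MVAlgebra.IsIdeal

variable {A : Type u} [MVAlgebra A] {I : Set A}

/-- The inclusion of the subalgebra `I ∪ ¬ I`. -/
def subtype (hI : IsIdeal I) : MVHom hI.Sub A where
  toFun x := x.1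
  map_zero' := rfl
  map_add' _ _ := rfl
  map_compl' _ := rfl

/-- The projection onto `A / I`. -/
def mkHom (hI : IsIdeal I) : MVHom A hI.Quot where
  toFun := hI.toQuot
  map_zero' := rfl
  map_add' _ _ := rfl
  map_compl' _ := rfl

end MVAlgebra.IsIdeal

instance {A : Type u} {B : Type v} [MVAlgebra A] [MVAlgebra B] : MVAlgebra (A × B) where
  compl x := (x.1ᶜ, x.2ᶜ)
  compl_compl' x := Prod.ext (compl_compl' x.1) (compl_compl' x.2)
  add_top' x := Prod.ext (add_top' x.1) (add_top' x.2)
  luk x y := Prod.ext (luk x.1 y.1) (luk x.2 y.2)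

/-! ### Zero objects and two-valued homomorphisms -/

namespace MVCat

open ZeroTorsion

/-- The homomorphism underlying an arrow of the category of MV-algebras. -/
abbrev toMVHom {A B : MVCat.{u}} (f : A ⟶ B) : MVHom A B := ConcreteCategory.hom f

theorem hom_ext' {A B : MVCat.{u}} {f g : A ⟶ B} (h : ∀ a, f a = g a) : f = g :=
  ConcreteCategory.hom_ext _ _ h

/-- A bijective homomorphism is an isomorphism. -/
theorem isIso_of_bijective {A B : MVCat.{u}} (f : A ⟶ B) (hf : Function.Bijective f) : IsIso f := by
  obtain ⟨g, hgf, hfg⟩ := Function.bijective_iff_has_inverse.1 hf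
  refine ⟨ConcreteCategory.ofHom (C := MVCat.{u}) (X := B) (Y := A)
    { toFun := g
      map_zero' := hf.1 (by rw [hfg, map_zero])
      map_add' := fun x y => hf.1 (by rw [map_add, hfg, hfg, hfg])
      map_compl' := fun x => hf.1 (by
        rw [MVHom.map_compl, hfg, hfg]) }, hom_ext' hgf, hom_ext' hfg⟩

theorem bijective_of_iso {A B : MVCat.{u}} (e : A ≅ B) : Function.Bijective e.hom :=
  Function.bijective_iff_has_inverse.2 ⟨e.inv, fun x => by simp, fun x => by simp⟩

/-- A homomorphism with values in the range of an injective one factors through it. -/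
theorem exists_lift {K A E : MVCat.{u}} (k : K ⟶ A) (hk : Function.Injective k) (e : E ⟶ A)
    (he : ∀ x, ∃ y, k y = e x) : ∃ φ : E ⟶ K, φ ≫ k = e := by
  choose g hg using he
  refine ⟨ConcreteCategory.ofHom (C := MVCat.{u}) (X := E) (Y := K)
    { toFun := g
      map_zero' := hk (by rw [hg, map_zero, map_zero])
      map_add' := fun x y => hk (by rw [map_add, hg, hg, hg, map_add])
      map_compl' := fun x => hk (by
        rw [MVHom.map_compl, hg, hg, MVHom.map_compl]) }, hom_ext' hg⟩

/-- A homomorphism that vanishes on the kernel of a surjective one factors through it. -/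
theorem exists_desc {A Q E : MVCat.{u}} (q : A ⟶ Q) (hq : Function.Surjective q) (e : A ⟶ E)
    (he : ∀ x, q x = 0 → e x = 0) : ∃ φ : Q ⟶ E, q ≫ φ = e := by
  have key : ∀ x y, q x = q y → le (e x) (e y) := fun x y h => by
    refine compl_injective ?_
    change sub (e x) (e y) = 0ᶜᶜ
    rw [← MVHom.map_sub', compl_compl']
    exact he _ (by rw [MVHom.map_sub', h, sub_self'])
  have key' : ∀ x y, q x = q y → e x = e y := fun x y h => by
    have h₁ := add_sub_of_le (key x y h)
    rwa [← MVHom.map_sub', he (sub y x) (by rw [MVHom.map_sub', h, sub_self']), add_zero] at h₁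
  choose g hg using hq
  have hgq : ∀ x, e (g (q x)) = e x := fun x => key' _ _ (hg _)
  refine ⟨ConcreteCategory.ofHom (C := MVCat.{u}) (X := Q) (Y := E)
    { toFun := fun x => e (g x)
      map_zero' := by rw [← map_zero (toMVHom e)]; exact key' _ _ (by rw [hg, map_zero])
      map_add' := fun x y => by
        rw [← map_add (toMVHom e)]
        exact key' _ _ (by rw [hg, map_add, hg, hg])
      map_compl' := fun x => by
        rw [← MVHom.map_compl]
        exact key' _ _ (by rw [hg, MVHom.map_compl, hg]) }, hom_ext' hgq⟩

theorem subsingleton_of_hom {A B : MVCat.{u}} (f : A ⟶ B) (h : Subsingleton A) : Subsingleton B :=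
  (toMVHom f).subsingleton

theorem subsingleton_trivialAlg : Subsingleton trivialAlg.{u} :=
  inferInstanceAs (Subsingleton PUnit)

theorem not_subsingleton_twoAlg : ¬ Subsingleton twoAlg.{u} := fun h => by
  have h' := h.elim Two.zero Two.one
  cases h'

theorem zeros_iff {A : MVCat.{u}} : zeros A ↔ ∀ a : A, a = 0 ∨ a = 0ᶜ := by
  constructor
  · rintro (⟨⟨e⟩⟩ | ⟨⟨e⟩⟩) a
    · have := subsingleton_of_hom e.inv subsingleton_trivialAlg
      exact Or.inl (Subsingleton.elim _ _)
    · have h : e.hom a = 0 ∨ e.hom a = 0ᶜ := by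
        generalize e.hom a = b
        rcases b with _ | _
        exacts [Or.inl rfl, Or.inr rfl]
      rw [← map_zero (toMVHom e.hom), ← MVHom.map_compl] at h
      exact h.imp (fun h => (bijective_of_iso e).1 h) fun h => (bijective_of_iso e).1 h
  · intro h
    by_cases hA : Subsingleton A
    · left
      let f : A ⟶ trivialAlg.{u} := ConcreteCategory.ofHom (C := MVCat.{u}) (X := A)
        (Y := trivialAlg)
        { toFun := fun _ => PUnit.unit
          map_zero' := rfl
          map_add' := fun _ _ => rfl
          map_compl' := fun _ => rfl }
      have := isIso_of_bijective f ⟨fun _ _ _ => Subsingleton.elim _ _, fun _ => ⟨0, rfl⟩⟩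
      exact ⟨asIso f⟩
    · right
      let f : twoAlg.{u} ⟶ A := ConcreteCategory.ofHom (C := MVCat.{u}) (X := twoAlg) (Y := A)
        { toFun := fun x => match x with
            | Two.zero => 0
            | Two.one => 0ᶜ
          map_zero' := rfl
          map_add' := by
            rintro (_ | _) (_ | _)
            exacts [(zero_add _).symm, (zero_add _).symm, (add_zero _).symm, (add_top' _).symm]
          map_compl' := by
            rintro (_ | _)
            exacts [rfl, (compl_compl' _).symm] }
      have hne : (0 : A)ᶜ ≠ 0 := fun h => hA (subsingleton_of_top_eq_zero h)
      have := isIso_of_bijective f ⟨by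
        rintro (_ | _) (_ | _) h
        exacts [rfl, (hne h.symm).elim, (hne h).elim, rfl], fun a => by
        rcases h a with rfl | rfl
        exacts [⟨Two.zero, rfl⟩, ⟨Two.one, rfl⟩]⟩
      exact ⟨(asIso f).symm⟩

theorem zeros_sub_zero (A : MVCat.{u}) : zeros ⟨(isIdeal_zero (A := A)).Sub⟩ :=
  zeros_iff.2 fun x => by
    rcases x.2 with h | h
    · exact Or.inl (Subtype.ext h)
    · exact Or.inr (Subtype.ext (compl_injective (by
        change x.1ᶜ = 0ᶜᶜ
        rw [compl_compl']
        exact h)))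

theorem factorsThrough_iff {A B : MVCat.{u}} {f : A ⟶ B} :
    FactorsThrough zeros f ↔ ∀ a, f a = 0 ∨ f a = 0ᶜ := by
  constructor
  · rintro ⟨Z₀, p, q, hZ, rfl⟩ a
    rw [comp_apply]
    rcases zeros_iff.1 hZ (p a) with h | h
    · exact Or.inl (by rw [h, map_zero])
    · exact Or.inr (by rw [h, MVHom.map_top])
  · intro h
    let ε : (⟨(isIdeal_zero (A := B)).Sub⟩ : MVCat.{u}) ⟶ B :=
      ConcreteCategory.ofHom (C := MVCat.{u}) (X := ⟨(isIdeal_zero (A := B)).Sub⟩) (Y := B)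
        isIdeal_zero.subtype
    obtain ⟨φ, hφ⟩ := exists_lift ε (fun _ _ h => Subtype.ext h) f fun x => ⟨⟨f x, by
      rcases h x with h | h
      · exact Or.inl h
      · right
        change (f x)ᶜ = 0
        rw [h, compl_compl']⟩, rfl⟩
    exact ⟨_, φ, ε, zeros_sub_zero B, hφ⟩

theorem factorsThrough_of_subsingleton {A B : MVCat.{u}} (f : A ⟶ B) (h : Subsingleton B) :
    FactorsThrough zeros f :=
  factorsThrough_iff.2 fun _ => Or.inl (Subsingleton.elim _ _)

theorem hom_ext_of_zeros {A Z₀ : MVCat.{u}} (hZ : zeros Z₀) (f g : Z₀ ⟶ A) : f = g :=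
  hom_ext' fun x => by
    rcases zeros_iff.1 hZ x with rfl | rfl
    · rw [map_zero, map_zero]
    · rw [MVHom.map_top, MVHom.map_top]

/-- A monomorphism into a trivial algebra has trivial domain, as it identifies the two projections
of the square of its domain. -/
theorem subsingleton_of_mono {A B : MVCat.{u}} (f : A ⟶ B) [Mono f] (hB : Subsingleton B) :
    Subsingleton A := by
  let p₁ : (⟨A × A⟩ : MVCat.{u}) ⟶ A :=
    ConcreteCategory.ofHom (C := MVCat.{u}) (X := ⟨A × A⟩) (Y := A)
      { toFun := Prod.fst
        map_zero' := rfl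
        map_add' := fun _ _ => rfl
        map_compl' := fun _ => rfl }
  let p₂ : (⟨A × A⟩ : MVCat.{u}) ⟶ A :=
    ConcreteCategory.ofHom (C := MVCat.{u}) (X := ⟨A × A⟩) (Y := A)
      { toFun := Prod.snd
        map_zero' := rfl
        map_add' := fun _ _ => rfl
        map_compl' := fun _ => rfl }
  have h : p₁ = p₂ := (cancel_mono f).1 (hom_ext' fun _ => Subsingleton.elim _ _)
  exact ⟨fun a b => congrArg (fun p : (⟨A × A⟩ : MVCat.{u}) ⟶ A => p (a, b)) h⟩

theorem injective_of_zeros {A Z₀ : MVCat.{u}} (hZ : zeros Z₀) (f : Z₀ ⟶ A)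
    (h : Subsingleton A → Subsingleton Z₀) : Function.Injective f := by
  by_cases hA : Subsingleton A
  · have := h hA
    exact fun _ _ _ => Subsingleton.elim _ _
  · have hne : (0 : A)ᶜ ≠ 0 := fun h => hA (subsingleton_of_top_eq_zero h)
    intro x y hxy
    rcases zeros_iff.1 hZ x with rfl | rfl <;> rcases zeros_iff.1 hZ y with rfl | rfl
    · rfl
    · rw [map_zero, MVHom.map_top] at hxy
      exact (hne hxy.symm).elim
    · rw [map_zero, MVHom.map_top] at hxy
      exact (hne hxy).elim
    · rfl

theorem exists_hom_of_zeros {A Z₁ Z₂ : MVCat.{u}} (z : Z₁ ⟶ A) (z' : Z₂ ⟶ A) (h₂ : zeros Z₂)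
    (hz : Function.Injective z) : ∃ φ : Z₂ ⟶ Z₁, φ ≫ z = z' :=
  exists_lift z hz z' fun x => by
    rcases zeros_iff.1 h₂ x with rfl | rfl
    · exact ⟨0, by rw [map_zero, map_zero]⟩
    · exact ⟨0ᶜ, by rw [MVHom.map_top, MVHom.map_top]⟩

theorem isZeroClass_zeros : IsZeroClass zeros.{u} where
  exists_mono A := by
    let ε : (⟨(isIdeal_zero (A := A)).Sub⟩ : MVCat.{u}) ⟶ A :=
      ConcreteCategory.ofHom (C := MVCat.{u}) (X := ⟨(isIdeal_zero (A := A)).Sub⟩) (Y := A)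
        isIdeal_zero.subtype
    exact ⟨_, ε, zeros_sub_zero A, ConcreteCategory.mono_of_injective ε fun _ _ h => Subtype.ext h⟩
  mono_unique ε₁ ε₂ h₁ h₂ m₁ m₂ := by
    obtain ⟨φ, hφ⟩ := exists_hom_of_zeros ε₂ ε₁ h₁
      (injective_of_zeros h₂ ε₂ (subsingleton_of_mono ε₂))
    obtain ⟨ψ, -⟩ := exists_hom_of_zeros ε₁ ε₂ h₂
      (injective_of_zeros h₁ ε₁ (subsingleton_of_mono ε₁))
    exact ⟨⟨φ, ψ, hom_ext_of_zeros h₁ _ _, hom_ext_of_zeros h₂ _ _⟩, hφ⟩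
  hom_unique h f g := hom_ext_of_zeros h f g
  factors z z' h₁ h₂ m := by
    obtain ⟨φ, hφ⟩ := exists_hom_of_zeros z z' h₂
      (injective_of_zeros h₁ z (subsingleton_of_mono z))
    exact ⟨φ, hφ, fun ψ _ => hom_ext_of_zeros h₂ _ _⟩

theorem nonempty_iso_of_zeros {A B : MVCat.{u}} (hA : zeros A) (hB : zeros B)
    (h : Subsingleton A ↔ Subsingleton B) : Nonempty (A ≅ B) := by
  rcases hA with ⟨⟨e⟩⟩ | ⟨⟨e⟩⟩ <;> rcases hB with ⟨⟨e'⟩⟩ | ⟨⟨e'⟩⟩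
  · exact ⟨e ≪≫ e'.symm⟩
  · exact (not_subsingleton_twoAlg (subsingleton_of_hom e'.hom
      (h.1 (subsingleton_of_hom e.inv subsingleton_trivialAlg)))).elim
  · exact (not_subsingleton_twoAlg (subsingleton_of_hom e.hom
      (h.2 (subsingleton_of_hom e'.inv subsingleton_trivialAlg)))).elim
  · exact ⟨e ≪≫ e'.symm⟩

/-! ### `Z`-kernels of MV-algebras -/

theorem isZKernel_of_injective {K A B : MVCat.{u}} {k : K ⟶ A} {f : A ⟶ B}
    (hk : Function.Injective k) (h : ∀ a, (∃ x, k x = a) ↔ f a = 0 ∨ f a = 0ᶜ) :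
    IsZKernel zeros k f where
  comp := factorsThrough_iff.2 fun x => (h (k x)).1 ⟨x, rfl⟩
  lift e he := by
    obtain ⟨φ, hφ⟩ := exists_lift k hk e fun x => (h (e x)).2 (factorsThrough_iff.1 he x)
    have := ConcreteCategory.mono_of_injective k hk
    exact ⟨φ, hφ, fun ψ hψ => (cancel_mono k).1 (hψ.trans hφ.symm)⟩

theorem isZKernel_iff {K A B : MVCat.{u}} {k : K ⟶ A} {f : A ⟶ B} :
    IsZKernel zeros k f ↔
      Function.Injective k ∧ ∀ a, (∃ x, k x = a) ↔ f a = 0 ∨ f a = 0ᶜ := by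
  refine ⟨fun h => ?_, fun h => isZKernel_of_injective h.1 h.2⟩
  -- `k` is compared with the inclusion of `I ∪ ¬ I`, where `I` is the kernel of `f`.
  have hI := MVHom.isIdeal_comap (toMVHom f) isIdeal_zero
  let ι : (⟨hI.Sub⟩ : MVCat.{u}) ⟶ A :=
    ConcreteCategory.ofHom (C := MVCat.{u}) (X := ⟨hI.Sub⟩) (Y := A) hI.subtype
  have hι : Function.Injective ι := fun _ _ h => Subtype.ext h
  have hr : ∀ a, (∃ x, ι x = a) ↔ f a = 0 ∨ f a = 0ᶜ := fun a => by
    rw [← compl_eq_zero_iff, ← MVHom.map_compl]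
    exact ⟨fun ⟨x, hx⟩ => hx ▸ x.2, fun h => ⟨⟨a, h⟩, rfl⟩⟩
  have hι' := isZKernel_of_injective hι hr
  obtain ⟨e, rfl⟩ := h.exists_iso hι' h.comp hι'.comp
  have he := bijective_of_iso e
  refine ⟨fun x y hxy => he.1 (hι hxy), fun a => ?_⟩
  rw [← hr]
  exact (he.2.exists (p := fun y => ι y = a)).symm

/-! ### The torsion theory -/

theorem perfect_cases {A : MVCat.{u}} (h : perfect A) (a : A) : a ∈ rad A ∨ aᶜ ∈ rad A :=
  Set.eq_univ_iff_forall.1 h a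

theorem perfect_of_forall {A : MVCat.{u}} (h : ∀ a : A, a ∈ rad A ∨ aᶜ ∈ rad A) : perfect A :=
  Set.eq_univ_of_forall h

theorem factorsThrough_of_perfect_of_semisimple {X Y : MVCat.{u}} (hX : perfect X)
    (hY : semisimple Y) (f : X ⟶ Y) : FactorsThrough zeros f := by
  have hf : ∀ x, x ∈ rad X → f x = 0 := fun x hx => by
    have h := MVHom.map_mem_rad (toMVHom f) hx
    have hY' : rad Y = {0} := hY
    rwa [hY'] at h
  refine factorsThrough_iff.2 fun x => (perfect_cases hX x).imp (hf x) fun h => ?_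
  rw [← hf _ h, MVHom.map_compl, compl_compl']

theorem perfect_of_iso {A B : MVCat.{u}} (e : A ≅ B) (hA : perfect A) : perfect B :=
  perfect_of_forall fun b => by
    obtain ⟨a, rfl⟩ := (bijective_of_iso e).2 b
    refine (perfect_cases hA a).imp (MVHom.map_mem_rad _) fun h => ?_
    rw [← MVHom.map_compl]
    exact MVHom.map_mem_rad _ h

theorem semisimple_of_iso {A B : MVCat.{u}} (e : A ≅ B) (hA : semisimple A) : semisimple B := by
  refine Set.eq_singleton_iff_unique_mem.2 ⟨(isIdeal_rad B).zero_mem, fun b hb => ?_⟩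
  have hA' : rad A = {0} := hA
  have h := MVHom.map_mem_rad (toMVHom e.inv) hb
  rw [hA', Set.mem_singleton_iff, ← map_zero (toMVHom e.inv)] at h
  exact (bijective_of_iso e.symm).1 h

theorem zeros_eq_inf : zeros.{u} = perfect ⊓ semisimple := by
  ext A
  constructor
  · intro h
    have h' := zeros_iff.1 h
    refine ⟨perfect_of_forall fun a => ?_,
      Set.eq_singleton_iff_unique_mem.2 ⟨(isIdeal_rad A).zero_mem, fun a ha => ?_⟩⟩
    · rcases h' a with rfl | rfl
      · exact Or.inl (isIdeal_rad A).zero_mem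
      · exact Or.inr (by rw [compl_compl']; exact (isIdeal_rad A).zero_mem)
    · exact MVHom.map_eq_zero_of_mem_rad (toMVHom (𝟙 A)) ha (h' a)
  · rintro ⟨hP, hS⟩
    have hS' : rad A = {0} := hS
    refine zeros_iff.2 fun a => (perfect_cases hP a).imp (fun h => ?_) fun h => ?_
    · rwa [hS'] at h
    · rw [hS', Set.mem_singleton_iff] at h
      rw [← h, compl_compl']

theorem proj_surjective (A : MVCat.{u}) : Function.Surjective (proj A) := Quotient.mk_surjective

theorem proj_eq_zero_iff {A : MVCat.{u}} {a : A} : proj A a = 0 ↔ a ∈ rad A :=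
  (isIdeal_rad A).toQuot_eq_zero_iff

theorem perfect_P (A : MVCat.{u}) : perfect (P A) := by
  have key : ∀ x : P A, incl A x ∈ rad A → x ∈ rad (P A) := fun x hx M hM => by
    by_contra hxM
    obtain ⟨n, hn⟩ := hM.exists_compl_nsmul_mem hxM
    -- The element `n x` of the radical lies below its negation, hence in `M`.
    have hle := le_compl_of_mem_rad ((isIdeal_rad A).nsmul_mem hx n)
    rw [← map_nsmul] at hle
    have hle' : le (n • x) (n • x)ᶜ := Subtype.ext hle
    exact hM.isIdeal.not_compl_mem hM.1.2 (hM.isIdeal.down hn hle') hn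
  exact perfect_of_forall fun x => x.2.imp (key x) (key xᶜ)

theorem semisimple_S (A : MVCat.{u}) : semisimple (S A) := by
  refine Set.eq_singleton_iff_unique_mem.2 ⟨(isIdeal_rad (S A)).zero_mem, fun b hb => ?_⟩
  obtain ⟨a, rfl⟩ := proj_surjective A b
  exact proj_eq_zero_iff.2 (MVHom.mem_rad_of_map_mem_rad _ (proj_surjective A)
    (fun _ h => proj_eq_zero_iff.1 h) hb)

theorem isTorsionSequence_incl_proj (A : MVCat.{u}) :
    IsTorsionSequence zeros perfect semisimple (incl A) (proj A) where
  torsion := perfect_P A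
  torsionFree := semisimple_S A
  exact :=
    { kernel := isZKernel_of_injective (fun _ _ h => Subtype.ext h) fun a => by
        rw [← compl_eq_zero_iff, ← MVHom.map_compl, proj_eq_zero_iff, proj_eq_zero_iff]
        exact ⟨fun ⟨x, hx⟩ => hx ▸ x.2, fun h => ⟨⟨a, h⟩, rfl⟩⟩
      cokernel :=
        { comp := factorsThrough_of_perfect_of_semisimple (perfect_P A) (semisimple_S A) _
          desc := fun e he => by
            obtain ⟨φ, hφ⟩ := exists_desc (proj A) (proj_surjective A) e fun x hx => by
              rw [proj_eq_zero_iff] at hx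
              exact MVHom.map_eq_zero_of_mem_rad _ hx
                (factorsThrough_iff.1 he ⟨x, Or.inl hx⟩)
            refine ⟨φ, hφ, fun ψ hψ => hom_ext' fun y => ?_⟩
            obtain ⟨a, rfl⟩ := proj_surjective A y
            rw [← comp_apply, ← comp_apply, hψ, hφ] } }

theorem exists_iso_incl_proj {T₀ A F₀ : MVCat.{u}} (t : T₀ ⟶ A) (η : A ⟶ F₀)
    (h : IsTorsionSequence zeros perfect semisimple t η) :
    ∃ (e : T₀ ≅ P A) (e' : F₀ ≅ S A), e.hom ≫ incl A = t ∧ η ≫ e'.hom = proj A :=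
  h.exists_iso factorsThrough_of_perfect_of_semisimple (isTorsionSequence_incl_proj A)

theorem isTorsionTheory : IsTorsionTheory zeros.{u} perfect semisimple where
  replete_torsion := ⟨fun e h => perfect_of_iso e h⟩
  replete_torsionFree := ⟨fun e h => semisimple_of_iso e h⟩
  inter := zeros_eq_inf
  hom := factorsThrough_of_perfect_of_semisimple
  exists_sequence A := ⟨_, _, _, _, isTorsionSequence_incl_proj A⟩

theorem surjective_of_isTorsionSequence {T₀ A F₀ : MVCat.{u}} {t : T₀ ⟶ A} {η : A ⟶ F₀}
    (h : IsTorsionSequence zeros perfect semisimple t η) : Function.Surjective η := by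
  obtain ⟨-, e', -, he'⟩ := exists_iso_incl_proj t η h
  intro y
  obtain ⟨a, ha⟩ := proj_surjective A (e'.hom y)
  rw [← he'] at ha
  exact ⟨a, (bijective_of_iso e').1 ha⟩

theorem eq_zero_iff_of_isTorsionSequence {T₀ A F₀ : MVCat.{u}} {t : T₀ ⟶ A} {η : A ⟶ F₀}
    (h : IsTorsionSequence zeros perfect semisimple t η) (a : A) : η a = 0 ↔ a ∈ rad A := by
  obtain ⟨-, e', -, he'⟩ := exists_iso_incl_proj t η h
  rw [← proj_eq_zero_iff, ← he', comp_apply]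
  exact ⟨fun h => by rw [h, map_zero],
    fun h => (bijective_of_iso e').1 (h.trans (map_zero _).symm)⟩

/-- The torsion-free part of an algebra is trivial only if the algebra is. -/
theorem subsingleton_of_isTorsionSequence {T₀ A F₀ : MVCat.{u}} {t : T₀ ⟶ A} {η : A ⟶ F₀}
    (h : IsTorsionSequence zeros perfect semisimple t η) (hF : Subsingleton F₀) :
    Subsingleton A :=
  subsingleton_of_top_mem_rad
    ((eq_zero_iff_of_isTorsionSequence h _).1 (Subsingleton.elim _ _))

theorem range_of_isTorsionSequence {T₀ A F₀ : MVCat.{u}} {t : T₀ ⟶ A} {η : A ⟶ F₀}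
    (h : IsTorsionSequence zeros perfect semisimple t η) (a : A) :
    (∃ x, t x = a) ↔ a ∈ rad A ∨ aᶜ ∈ rad A := by
  rw [(isZKernel_iff.1 h.exact.kernel).2, ← compl_eq_zero_iff, ← MVHom.map_compl,
    eq_zero_iff_of_isTorsionSequence h, eq_zero_iff_of_isTorsionSequence h]

/-! ### Conditions (M), (S) and (N) -/

theorem conditionM : ConditionM zeros.{u} perfect semisimple := by
  intro X A Q k q hX hkq T₀ F₀ t η hη Z₀ ε hZ hε
  have hF : zeros F₀ := zeros_iff.2 fun y => by
    obtain ⟨x, rfl⟩ := surjective_of_isTorsionSequence hη y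
    exact factorsThrough_iff.1
      (factorsThrough_of_perfect_of_semisimple hX hη.torsionFree η) x
  refine nonempty_iso_of_zeros hF hZ ⟨fun h => ?_, fun h => ?_⟩
  · have hX' := subsingleton_of_isTorsionSequence hη h
    exact subsingleton_of_mono ε (subsingleton_of_hom (k ≫ q) hX')
  · have hQ := subsingleton_of_hom ε h
    -- As `Q` is trivial, `k` is split by an arrow `A ⟶ X`, and `A ⟶ S A` factors through `Q`.
    obtain ⟨φ, -, -⟩ := hkq.kernel.lift (𝟙 A) (factorsThrough_of_subsingleton _ hQ)
    obtain ⟨ψ, -, -⟩ := hkq.cokernel.desc (proj A)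
      (factorsThrough_of_perfect_of_semisimple hX (semisimple_S A) _)
    have hA : Subsingleton A :=
      subsingleton_of_isTorsionSequence (isTorsionSequence_incl_proj A)
        (subsingleton_of_hom ψ hQ)
    exact subsingleton_of_hom (φ ≫ η) hA

/-- An arrow from a perfect algebra to a zero object is the unit of its domain, unless it maps a
nontrivial algebra to the trivial one. -/
theorem isTorsionSequence_id {X Z₀ : MVCat.{u}} (hX : perfect X) (hZ : zeros Z₀) (χ : X ⟶ Z₀)
    (h : Subsingleton Z₀ → Subsingleton X) :
    IsTorsionSequence zeros perfect semisimple (𝟙 X) χ where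
  torsion := hX
  torsionFree := (zeros_eq_inf ▸ hZ : (perfect ⊓ semisimple) Z₀).2
  exact :=
    { kernel :=
        { comp := ⟨Z₀, χ, 𝟙 _, hZ, by simp⟩
          lift := fun e _ => ⟨e, by simp, fun ψ hψ => by simpa using hψ⟩ }
      cokernel :=
        { comp := ⟨Z₀, χ, 𝟙 _, hZ, by simp⟩
          desc := fun e he => by
            have he' := factorsThrough_iff.1 he
            obtain ⟨φ, hφ⟩ := exists_desc χ (fun y => by
                rcases zeros_iff.1 hZ y with rfl | rfl
                exacts [⟨0, map_zero _⟩, ⟨0ᶜ, MVHom.map_top _⟩]) e fun x hx => by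
              rcases perfect_cases hX x with hr | hr
              · exact MVHom.map_eq_zero_of_mem_rad (toMVHom e) hr (he' x)
              · -- Here `χ x` is `0` and `1` at the same time.
                have hr' := MVHom.map_eq_zero_of_mem_rad (toMVHom χ) hr
                  (zeros_iff.1 hZ _)
                rw [MVHom.map_compl, hx] at hr'
                have := h (subsingleton_of_top_eq_zero hr')
                rw [Subsingleton.elim x 0, map_zero]
            exact ⟨φ, hφ, fun ψ _ => hom_ext_of_zeros hZ _ _⟩ } }

theorem conditionS : ConditionS zeros.{u} perfect semisimple := by
  rintro X' Z₁ X Z₀ χ p z η hX hZ₀ hZ₁ ⟨T₀, t, ht⟩ hpb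
  suffices h : perfect X' ∧ (Subsingleton Z₁ → Subsingleton X') from
    ⟨h.1, _, _, isTorsionSequence_id h.1 hZ₁ χ h.2⟩
  by_cases h₀ : Subsingleton Z₀
  · -- Then `X` is trivial, so that `η` and its pullback `χ` are isomorphisms.
    have hX₀ := subsingleton_of_isTorsionSequence ht h₀
    have := isIso_of_bijective η
      ⟨fun _ _ _ => Subsingleton.elim _ _, fun _ => ⟨0, Subsingleton.elim _ _⟩⟩
    have : IsIso χ := hpb.isIso_fst_of_isIso
    exact ⟨perfect_of_iso (asIso χ).symm (zeros_eq_inf ▸ hZ₁ : (perfect ⊓ semisimple) Z₁).1,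
      subsingleton_of_hom (inv χ)⟩
  · -- Then `z` and its pullback `p` are isomorphisms.
    have h₁ : ¬ Subsingleton Z₁ := fun h => h₀ (subsingleton_of_hom z h)
    have := isIso_of_bijective z ⟨injective_of_zeros hZ₁ z fun h => (h₀ h).elim, fun y => by
      rcases zeros_iff.1 hZ₀ y with rfl | rfl
      exacts [⟨0, map_zero _⟩, ⟨0ᶜ, MVHom.map_top _⟩]⟩
    have : IsIso p := hpb.isIso_snd_of_isIso
    exact ⟨perfect_of_iso (asIso p).symm hX, fun h => (h₁ h).elim⟩

theorem conditionN : ConditionN zeros.{u} perfect semisimple := by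
  intro A B K f k hk T₀ F₀ t η ht
  obtain ⟨hinj, hrange⟩ := isZKernel_iff.1 hk
  -- The radical of `K` is an ideal of `A`, because `f` vanishes on it and `K` contains the kernel
  -- of `f`.
  have hJ : IsIdeal (k '' rad K) :=
    { nonempty := (isIdeal_rad K).nonempty.image k
      down := by
        rintro _ y ⟨x, hx, rfl⟩ hle
        have hfx : f (k x) = 0 :=
          MVHom.map_eq_zero_of_mem_rad (toMVHom (k ≫ f)) hx ((hrange _).1 ⟨x, rfl⟩)
        have hfy : f y = 0 := by
          have := MVHom.map_le (toMVHom f) hle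
          rw [hfx] at this
          exact eq_zero_of_le_zero this
        obtain ⟨w, rfl⟩ := (hrange y).2 (Or.inl hfy)
        refine ⟨w, (isIdeal_rad K).down hx (hinj ?_), rfl⟩
        rw [map_add, MVHom.map_compl, MVHom.map_top]
        exact hle
      add := by
        rintro _ _ ⟨x, hx, rfl⟩ ⟨y, hy, rfl⟩
        exact ⟨x + y, (isIdeal_rad K).add hx hy, map_add _ x y⟩ }
  let g : A ⟶ ⟨hJ.Quot⟩ :=
    ConcreteCategory.ofHom (C := MVCat.{u}) (X := A) (Y := ⟨hJ.Quot⟩) hJ.mkHom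
  have hg : ∀ a, g a = 0 ↔ a ∈ k '' rad K := fun a => hJ.toQuot_eq_zero_iff
  refine ⟨_, g, isZKernel_of_injective
    (fun x y h => (isZKernel_iff.1 ht.exact.kernel).1 (hinj h)) fun a => ?_⟩
  rw [← compl_eq_zero_iff, ← MVHom.map_compl, hg, hg]
  constructor
  · rintro ⟨x, rfl⟩
    rw [comp_apply, ← MVHom.map_compl]
    exact ((range_of_isTorsionSequence ht _).1 ⟨x, rfl⟩).imp (fun h => ⟨_, h, rfl⟩)
      fun h => ⟨_, h, rfl⟩
  · intro h
    have : ∃ y, k y = a ∧ (y ∈ rad K ∨ yᶜ ∈ rad K) := by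
      rcases h with ⟨y, hy, rfl⟩ | ⟨y, hy, hya⟩
      · exact ⟨y, rfl, Or.inl hy⟩
      · refine ⟨yᶜ, ?_, Or.inr (by rwa [compl_compl'])⟩
        rw [MVHom.map_compl, hya, compl_compl']
    obtain ⟨y, rfl, hy⟩ := this
    obtain ⟨x, rfl⟩ := (range_of_isTorsionSequence ht y).2 hy
    exact ⟨x, rfl⟩

end MVCat

theorem mainTheorem8 :
    ZeroTorsion.IsZeroClass MVCat.zeros.{u} ∧
    ZeroTorsion.IsTorsionTheory MVCat.zeros.{u} MVCat.perfect.{u} MVCat.semisimple.{u} ∧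
    (∀ A : MVCat.{u}, ZeroTorsion.IsTorsionSequence MVCat.zeros MVCat.perfect MVCat.semisimple
      (MVCat.incl A) (MVCat.proj A)) ∧
    (∀ {T₀ A F₀ : MVCat.{u}} (t : T₀ ⟶ A) (η : A ⟶ F₀),
      ZeroTorsion.IsTorsionSequence MVCat.zeros MVCat.perfect MVCat.semisimple t η →
        ∃ (e : T₀ ≅ MVCat.P A) (e' : F₀ ≅ MVCat.S A),
          e.hom ≫ MVCat.incl A = t ∧ η ≫ e'.hom = MVCat.proj A) ∧
    ZeroTorsion.ConditionM MVCat.zeros.{u} MVCat.perfect.{u} MVCat.semisimple.{u} ∧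
    ZeroTorsion.ConditionS MVCat.zeros.{u} MVCat.perfect.{u} MVCat.semisimple.{u} ∧
    ZeroTorsion.ConditionN MVCat.zeros.{u} MVCat.perfect.{u} MVCat.semisimple.{u} := by

  exact ⟨MVCat.isZeroClass_zeros, MVCat.isTorsionTheory, MVCat.isTorsionSequence_incl_proj,
    MVCat.exists_iso_incl_proj, MVCat.conditionM, MVCat.conditionS, MVCat.conditionN⟩
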